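/- All groups are finite, and $o(\cdot)$ denotes the order of an element. For $m \mid n$, let $C_n$ be the cyclic group of order $n$ and $C_{n,m}$ its unique subgroup of order $m$. For $n\ge 1$ let $\mathrm{Min}(n)$ be the class of all finite groups $G$ with $|G|<n$ such that for every normal subgroup $N$ of $G$, every $x\in G$ and every $u\in C_{|G|}$ for which the order of $xN$ in $G/N$ equals the order of $uC_{|G|,|N|}$ in $C_{|G|}/C_{|G|,|N|}$, there is a bijection $f$ from $xN$ onto $uC_{|G|,|N|}$ with $o(xh)\mid o(f(xh))$ for all $h\in N$. Call a finite group semisimple if it has no nontrivial abelian normal subgroup. Let $\mathrm{AM}(n)$ be the class of all finite semisimple groups $G$ with $|G|<n$ that have an element $y$ and a minimal normal subgroup $N$ such that $G=\langle y\rangle N$ and either $N$ is a non-abelian simple group, or $o(y)$ is a prime number and $N$ is isomorphic to the direct product of $o(y)$ copies of a non-abelian simple group. Theorem. Let $n\ge 1$, suppose that $\mathrm{AM}(n+1)\subseteq \mathrm{Min}(n+1)$, and let $G$ be a finite group of order $n$. Then: (a) For every normal subgroup $N$ of $G$, every $y\in G$ and every $u\in C_n$ such that the order of $uC_{n,|N|}$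 in $C_n/C_{n,|N|}$ equals the order of $yN$ in $G/N$, there is a bijection $f$ from $yN$ onto $uC_{n,|N|}$ such that $o(yh)\mid o(f(yh))$ for all $h\in N$. (b) There is a bijection $f$ from $G$ onto $C_n$ such that $o(x)\mid o(f(x))$ for all $x\in G$. Consequently, if $\mathrm{AM}(n)\subseteq \mathrm{Min}(n)$ for all $n\ge 1$, then every finite group $G$ admits a bijection $f$ onto the cyclic group of order $|G|$ such that $o(x)\mid o(f(x))$ for all $x\in G$. -/

import Mathlib

open scoped Pointwise

universe u

/-- The cyclic group `C_n` of order `n` (for `n ≥ 1`), written multiplicatively. -/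
abbrev CyclicGrp (n : ℕ) : Type := Multiplicative (ZMod n)

/-- `C_{n,m}`: for `m ∣ n`, the unique subgroup of order `m` of `C_n`, realised as the set of
solutions of `x ^ m = 1` in `C_n`. -/
def cyclicSub (n m : ℕ) : Subgroup (CyclicGrp n) :=
  (powMonoidHom m : CyclicGrp n →* CyclicGrp n).ker

theorem card_cyclicSub (n m : ℕ) (hn : n ≠ 0) (hm : m ∣ n) :
    Nat.card (cyclicSub n m) = m := by
  have : NeZero n := ⟨hn⟩
  have h := IsCyclic.card_powMonoidHom_ker (CyclicGrp n) m
  have hc : Nat.card (CyclicGrp n) = n := by simp [CyclicGrp]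
  rw [hc, Nat.gcd_eq_right hm] at h
  exact h

theorem eq_cyclicSub (n m : ℕ) (hn : n ≠ 0) (hm : m ∣ n) (K : Subgroup (CyclicGrp n))
    (hK : Nat.card K = m) : K = cyclicSub n m := by
  have : NeZero n := ⟨hn⟩
  have hle : K ≤ cyclicSub n m := by
    intro x hx
    have h : (⟨x, hx⟩ : K) ^ Nat.card K = 1 := pow_card_eq_one'
    rw [hK] at h
    exact congrArg Subtype.val h
  exact Subgroup.eq_of_le_of_card_ge hle (by rw [card_cyclicSub n m hn hm, hK])

/-- There is a bijection `f` from the coset `xN` onto the coset `u C_{|G|,|N|}` of `C_{|G|}` such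
that `o(xh)` divides `o(f(xh))` for all `h ∈ N`. -/
def HasCosetBijection {G : Type u} [Group G] (N : Subgroup G) (x : G)
    (v : CyclicGrp (Nat.card G)) : Prop :=
  ∃ f : G → CyclicGrp (Nat.card G),
    Set.BijOn f (x • (N : Set G))
      (v • (cyclicSub (Nat.card G) (Nat.card N) : Set (CyclicGrp (Nat.card G)))) ∧
    ∀ h ∈ N, orderOf (x * h) ∣ orderOf (f (x * h))

/-- There is a bijection from `G` onto the cyclic group `C_n` such that the order of `x` divides
the order of `f x` for all `x`. -/
def HasCyclicBijection (n : ℕ) (G : Type u) [Group G] : Prop :=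
  ∃ f : G → CyclicGrp n, Function.Bijective f ∧ ∀ x : G, orderOf x ∣ orderOf (f x)

/-- Membership of `G` in the class `Min(n)`. -/
def InMin (n : ℕ) (G : Type u) [Group G] : Prop :=
  Finite G ∧ Nat.card G < n ∧
    ∀ (N : Subgroup G) [N.Normal] (x : G) (v : CyclicGrp (Nat.card G)),
      orderOf (x : G ⧸ N) =
        orderOf (v : CyclicGrp (Nat.card G) ⧸ cyclicSub (Nat.card G) (Nat.card N)) →
      HasCosetBijection N x v

/-- A group without nontrivial abelian normal subgroups. -/
def IsSemisimpleGrp (G : Type u) [Group G] : Prop :=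
  ∀ A : Subgroup G, A.Normal → (∀ a ∈ A, ∀ b ∈ A, a * b = b * a) → A = ⊥

/-- A non-abelian simple group. -/
def IsNonabelianSimple (L : Type u) [Group L] : Prop :=
  IsSimpleGroup L ∧ ∃ a b : L, a * b ≠ b * a

/-- A minimal normal subgroup: minimal among the nontrivial normal subgroups. -/
def IsMinimalNormal {G : Type u} [Group G] (N : Subgroup G) : Prop :=
  Minimal (fun K : Subgroup G => K.Normal ∧ K ≠ ⊥) N

/-- Membership of `G` in the class `AM(n)`. -/
def InAM (n : ℕ) (G : Type u) [Group G] : Prop :=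
  Finite G ∧ Nat.card G < n ∧ IsSemisimpleGrp G ∧
    ∃ (y : G) (N : Subgroup G), IsMinimalNormal N ∧ Subgroup.zpowers y ⊔ N = ⊤ ∧
      (IsNonabelianSimple N ∨
        ((orderOf y).Prime ∧ ∃ (L : Type u) (_ : Group L), IsNonabelianSimple L ∧
          Nonempty (N ≃* (Fin (orderOf y) → L))))

/-! In a cyclic group, the orders occurring in a coset of the subgroup of order k depend only on k
and the order m of the coset in the quotient. Write k = ab with b coprime to m and a dividing a
power of m. The orders are then ma times the orders of the elements of C_b, each taken a times;
`cosetWeight m k` lists them. The theorem thus becomes a statement `FiberDom φ q` about the fibers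
of surjections φ from G, with no ambient cyclic group.

It is proved by induction on |G|, then on |ker φ|. If q does not generate the target, the fiber lies
in a smaller group. If N = ker φ is not minimal normal, φ factors through a proper quotient of G and
the two bijections compose (`FiberDom.comp`). If N is abelian and minimal, it has prime exponent p
and a direct count works (`FiberDom.of_forall_pow_prime_eq_one`).

Let N be non-abelian and minimal, and choose M ≤ N minimal among the nontrivial subgroups normalized
by N. Let B be the group of automorphisms of M induced by its normalizer. If t is the least positive
exponent with y^t normalizing M, then x ↦ (x^t acting on M) maps the coset yN onto a coset of Inn(M)
in B with fibers of equal size, and o(x) divides the lcm of o(yN) and t times the order of the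
image. A bijection for B therefore lifts to G (`FiberDom.of_inducedAut`). Induction applies unless
|B| ≥ |G|. In that case M = N is simple with trivial centralizer, so G lies in the class AM
(`IsMinimalNormalIn.inAM`) and the hypothesis finishes the proof. -/

/-! ### Bijections assembled fiber by fiber -/

section Fibers

variable {α β γ δ : Type*}

/-- There is a bijection along which each value of `a` divides the corresponding value of `b`. -/
def WeightDom (a : α → ℕ) (b : β → ℕ) : Prop :=
  ∃ e : α ≃ β, ∀ x, a x ∣ b (e x)

theorem WeightDom.trans {a : α → ℕ} {b : β → ℕ} {c : γ → ℕ} (h₁ : WeightDom a b)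
    (h₂ : WeightDom b c) : WeightDom a c := by
  obtain ⟨e, he⟩ := h₁
  obtain ⟨f, hf⟩ := h₂
  exact ⟨e.trans f, fun x => (he x).trans (hf (e x))⟩

theorem WeightDom.of_fibers {a : α → ℕ} {b : β → ℕ} (f : α → γ) (g : β → δ) (e : γ ≃ δ)
    (h : ∀ c, WeightDom (fun x : {x // f x = c} => a x.1)
      (fun y : {y // g y = e c} => b y.1)) : WeightDom a b := by
  choose E hE using h
  refine ⟨(Equiv.sigmaFiberEquiv f).symm.trans ((Equiv.sigmaCongr e E).trans
    (Equiv.sigmaFiberEquiv g)), fun x => ?_⟩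
  exact hE (f x) ⟨x, rfl⟩

/-- All fibers of `f` have the same cardinality. -/
def ConstFibers (f : α → γ) : Prop :=
  ∀ c d, Nat.card {x // f x = c} = Nat.card {x // f x = d}

theorem ConstFibers.of_moves [Finite α] {f : α → γ}
    (h : ∀ c d, ∃ σ : α → α, σ.Injective ∧ ∀ x, f x = c → f (σ x) = d) : ConstFibers f := by
  have key : ∀ c d, Nat.card {x // f x = c} ≤ Nat.card {x // f x = d} := by
    intro c d
    obtain ⟨σ, hσ, hf⟩ := h c d
    exact Nat.card_le_card_of_injective
      (fun x : {x // f x = c} => (⟨σ x.1, hf x.1 x.2⟩ : {x // f x = d}))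
      fun x y hxy => Subtype.ext (hσ (congrArg Subtype.val hxy))
  exact fun c d => le_antisymm (key c d) (key d c)

theorem ConstFibers.card_eq [Finite α] [Finite γ] {f : α → γ} (h : ConstFibers f) (c : γ) :
    Nat.card α = Nat.card γ * Nat.card {x // f x = c} := by
  have : Fintype γ := Fintype.ofFinite γ
  rw [← Nat.card_congr (Equiv.sigmaFiberEquiv f), Nat.card_sigma,
    Finset.sum_congr rfl fun d _ => h d c]
  simp

/-- Equal total sizes over equinumerous bases force equal fiber sizes, so any bijection of the bases
lifts. -/
theorem ConstFibers.exists_equiv [Finite α] [Finite β] [Finite γ] [Finite δ] {f : α → γ}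
    {g : β → δ} (hf : ConstFibers f) (hg : ConstFibers g) (hc : Nat.card α = Nat.card β)
    (e : γ ≃ δ) : ∃ E : α ≃ β, ∀ x, g (E x) = e (f x) := by
  have h : ∀ c, Nat.card {x // f x = c} = Nat.card {y // g y = e c} := by
    intro c
    have h₁ := hf.card_eq c
    rw [hc, hg.card_eq (e c), Nat.card_congr e] at h₁
    have : Nonempty δ := ⟨e c⟩
    exact (Nat.eq_of_mul_eq_mul_left Nat.card_pos h₁).symm
  let E := fun c => Classical.choice (Finite.card_eq.1 (h c))
  refine ⟨(Equiv.sigmaFiberEquiv f).symm.trans ((Equiv.sigmaCongr e E).trans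
    (Equiv.sigmaFiberEquiv g)), fun x => ?_⟩
  exact (E (f x) ⟨x, rfl⟩).2

theorem ConstFibers.zmodCast {k d : ℕ} [NeZero k] (h : d ∣ k) :
    ConstFibers (ZMod.castHom h (ZMod d)) := by
  refine ConstFibers.of_moves fun c c' => ?_
  obtain ⟨s, hs⟩ := ZMod.castHom_surjective h (c' - c)
  refine ⟨fun x => x + s, add_left_injective s, fun x hx => ?_⟩
  rw [map_add, hx, hs]
  ring

end Fibers

/-! ### Arithmetic of the orders in a cyclic coset -/

section Weights

/-- Divide out gcd(k, m) until it is 1; what was removed divides a power of m. -/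
theorem exists_coprime_decomposition (m k : ℕ) (hk : k ≠ 0) :
    ∃ b a j : ℕ, k = a * b ∧ a ∣ m ^ j ∧ b.Coprime m := by
  induction k using Nat.strong_induction_on with
  | _ k ih =>
    by_cases hg : k.Coprime m
    · exact ⟨k, 1, 0, by simp, by simp, hg⟩
    · have hgk : k.gcd m ∣ k := Nat.gcd_dvd_left k m
      obtain ⟨c, hc⟩ := hgk
      have hg0 : 0 < k.gcd m := Nat.gcd_pos_of_pos_left _ (Nat.pos_of_ne_zero hk)
      have hg1 : 1 < k.gcd m := lt_of_le_of_ne hg0 (Ne.symm hg)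
      have hc0 : c ≠ 0 := by
        rintro rfl
        exact hk (by simpa using hc)
      have hck : c < k := by
        have h := Nat.mul_lt_mul_of_pos_right hg1 (Nat.pos_of_ne_zero hc0)
        rwa [one_mul, ← hc] at h
      obtain ⟨b, a, j, h₁, h₂, h₃⟩ := ih c hck hc0
      refine ⟨b, k.gcd m * a, j + 1, ?_, ?_, h₃⟩
      · rw [mul_assoc, ← h₁]
        exact hc
      · rw [pow_succ', mul_comm m]
        rw [mul_comm]
        exact mul_dvd_mul h₂ (Nat.gcd_dvd_right k m)

open Classical in
/-- The largest divisor of `k` that is coprime to `m`. -/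
noncomputable def coprimePart (m k : ℕ) : ℕ :=
  if hk : k ≠ 0 then (exists_coprime_decomposition m k hk).choose else 0

theorem coprimePart_spec {m k : ℕ} (hk : k ≠ 0) :
    ∃ a j : ℕ, k = a * coprimePart m k ∧ a ∣ m ^ j ∧ (coprimePart m k).Coprime m := by
  rw [coprimePart, dif_pos hk]
  exact (exists_coprime_decomposition m k hk).choose_spec

/-- The orders of the elements of a coset, of order `m` in the quotient, of the subgroup of
order `k` of a cyclic group, listed in a standard way. -/
noncomputable def cosetWeight (m k : ℕ) (i : ZMod k) : ℕ :=
  m * (k / (coprimePart m k).gcd i.val)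

theorem coprimePart_dvd {m k : ℕ} (hk : k ≠ 0) : coprimePart m k ∣ k := by
  obtain ⟨a, j, h, -, -⟩ := coprimePart_spec (m := m) hk
  exact Dvd.intro_left a h.symm

/-- Cleared of denominators, this says that the order of i in ℤ/b divides its order in ℤ/c. -/
theorem mul_gcd_dvd_mul_gcd {b c : ℕ} (h : b ∣ c) (i : ℕ) : b * c.gcd i ∣ c * b.gcd i := by
  rw [← Nat.gcd_mul_left, ← Nat.gcd_mul_left, mul_comm b c]
  exact Nat.gcd_dvd_gcd_of_dvd_right _ (Nat.mul_dvd_mul_right h i)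

theorem coprime_of_dvd_pow {a b m j : ℕ} (ha : a ∣ m ^ j) (hb : b.Coprime m) : a.Coprime b :=
  Nat.Coprime.coprime_dvd_left ha (Nat.Coprime.pow_left j hb.symm)

theorem val_castHom {k d : ℕ} [NeZero k] (h : d ∣ k) (i : ZMod k) :
    (ZMod.castHom h (ZMod d) i).val = i.val % d := by
  rw [ZMod.castHom_apply, ZMod.cast_eq_val, ZMod.val_natCast]

theorem gcd_mod_of_dvd {b d : ℕ} (h : b ∣ d) (i : ℕ) : b.gcd (i % d) = b.gcd i := by
  apply Nat.dvd_antisymm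
  · refine Nat.dvd_gcd (Nat.gcd_dvd_left _ _) ?_
    exact (Nat.dvd_mod_iff ((Nat.gcd_dvd_left _ _).trans h)).1 (Nat.gcd_dvd_right _ _)
  · refine Nat.dvd_gcd (Nat.gcd_dvd_left _ _) ?_
    exact (Nat.dvd_mod_iff ((Nat.gcd_dvd_left _ _).trans h)).2 (Nat.gcd_dvd_right _ _)

/-- The monotonicity behind both reductions: t = 1 and k₁ = k for composing quotients, t the
normalizing exponent for the passage to induced automorphisms. The part b of k₁ coprime to m divides
the coprime parts of both (m, k) and (m₁, k₁), and its cofactor in k₁ divides the cofactor in k. -/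
theorem mul_cosetWeight_dvd {m m₁ k k₁ t : ℕ} [NeZero k] (hm : t * m₁ ∣ m) (hk : k₁ ∣ k)
    (i : ZMod k) : t * cosetWeight m₁ k₁ (ZMod.castHom hk (ZMod k₁) i) ∣ cosetWeight m k i := by
  have hk0 : k ≠ 0 := NeZero.ne k
  have hk₁0 : k₁ ≠ 0 := ne_zero_of_dvd_ne_zero hk0 hk
  have hmm : m₁ ∣ m := (Dvd.intro_left t rfl).trans hm
  obtain ⟨c, j, hc, hcj, hcop⟩ := coprimePart_spec (m := m) hk0
  obtain ⟨c₁, j₁, hc₁, hcj₁, hcop₁⟩ := coprimePart_spec (m := m₁) hk₁0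
  obtain ⟨b, a, l, hab, hal, hb⟩ := exists_coprime_decomposition m k₁ hk₁0
  have hd₁ := coprimePart_dvd (m := m₁) hk₁0
  have hd := coprimePart_dvd (m := m) hk0
  unfold cosetWeight
  rw [val_castHom, gcd_mod_of_dvd hd₁]
  generalize i.val = i
  generalize coprimePart m k = d at *
  generalize coprimePart m₁ k₁ = d₁ at *
  have hac : a ∣ c := by
    refine (coprime_of_dvd_pow hal hcop).dvd_of_dvd_mul_right ?_
    rw [← hc]
    exact (Dvd.intro b hab.symm).trans hk
  have hbd : b ∣ d := by
    refine (coprime_of_dvd_pow hcj hb).symm.dvd_of_dvd_mul_left ?_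
    rw [← hc]
    exact (Dvd.intro_left a hab.symm).trans hk
  have hbd₁ : b ∣ d₁ := by
    refine (coprime_of_dvd_pow (hcj₁.trans (pow_dvd_pow_of_dvd hmm j₁)) hb).symm.dvd_of_dvd_mul_left ?_
    rw [← hc₁]
    exact Dvd.intro_left a hab.symm
  have hg : 0 < d.gcd i := Nat.gcd_pos_of_pos_left _
    (Nat.pos_of_ne_zero (ne_zero_of_dvd_ne_zero hk0 hd))
  have hg₁ : 0 < d₁.gcd i := Nat.gcd_pos_of_pos_left _
    (Nat.pos_of_ne_zero (ne_zero_of_dvd_ne_zero hk₁0 hd₁))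
  have key : k₁ / d₁.gcd i ∣ k / d.gcd i := by
    have h₂ : k₁ * d.gcd i ∣ k * d₁.gcd i := by
      rw [hab, hc, mul_assoc, mul_assoc]
      refine mul_dvd_mul hac ((mul_gcd_dvd_mul_gcd hbd i).trans ?_)
      exact mul_dvd_mul_left d (Nat.gcd_dvd_gcd_of_dvd_left i hbd₁)
    obtain ⟨x, hx⟩ := (Nat.gcd_dvd_left d i).trans hd
    obtain ⟨x₁, hx₁⟩ := (Nat.gcd_dvd_left d₁ i).trans hd₁
    have e : k / d.gcd i = x := by rw [hx, Nat.mul_div_cancel_left _ hg]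
    have e₁ : k₁ / d₁.gcd i = x₁ := by rw [hx₁, Nat.mul_div_cancel_left _ hg₁]
    rw [e, e₁]
    rw [hx, hx₁] at h₂
    refine Nat.dvd_of_mul_dvd_mul_left (Nat.mul_pos hg hg₁) ?_
    convert h₂ using 1 <;> ring
  rw [← mul_assoc]
  exact mul_dvd_mul hm key

theorem dvd_cosetWeight (m k : ℕ) (i : ZMod k) : m ∣ cosetWeight m k i :=
  Dvd.intro _ rfl

end Weights

/-! ### Orders in cosets of cyclic groups -/

section CyclicCosets

theorem MonoidHom.card_ker_mul_card_range {G Q : Type*} [Group G] [Group Q] (φ : G →* Q) :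
    Nat.card φ.ker * Nat.card φ.range = Nat.card G := by
  rw [← Subgroup.index_ker, Subgroup.card_mul_index]

theorem MonoidHom.card_fiber {G Q : Type*} [Group G] [Group Q] (φ : G →* Q) (x : G) :
    Nat.card {y // φ y = φ x} = Nat.card φ.ker :=
  Nat.card_congr (φ.fiberEquivKer x)

theorem exists_equiv_zmod_orderOf {C : Type*} [Group C] [Finite C] [IsCyclic C] {b : ℕ}
    (hb : Nat.card C = b) : ∃ e : C ≃ ZMod b, ∀ c, orderOf c = b / b.gcd (e c).val := by
  subst hb
  have h0 : Nat.card C ≠ 0 := Nat.card_pos.ne'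
  have : NeZero (Nat.card C) := ⟨h0⟩
  let E := zmodCyclicMulEquiv (G := C) inferInstance
  refine ⟨E.symm.toEquiv.trans Multiplicative.toAdd, fun c => ?_⟩
  rw [← ZMod.addOrderOf_coe _ h0, ZMod.natCast_zmod_val, ← orderOf_ofAdd_eq_addOrderOf]
  exact (E.symm.orderOf_eq c).symm

variable {A : Type*} [CommGroup A] [Finite A] [IsCyclic A]

theorem mem_iff_pow_card_eq_one (K : Subgroup A) (x : A) : x ∈ K ↔ x ^ Nat.card K = 1 := by
  have h : K = (powMonoidHom (Nat.card K) : A →* A).ker := by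
    refine Subgroup.eq_of_le_of_card_ge (fun y hy => ?_) ?_
    · exact congrArg Subtype.val (pow_card_eq_one' (x := (⟨y, hy⟩ : K)))
    · rw [IsCyclic.card_powMonoidHom_ker, Nat.gcd_eq_right K.card_subgroup_dvd_card]
  constructor
  · intro hx
    rw [h] at hx
    exact hx
  · intro hx
    rw [h]
    exact hx

/-- Restrict φ to ⟨x⟩: its kernel is the set of solutions of z^|ker φ| = 1 in a cyclic group of
order o(x). -/
theorem orderOf_eq_orderOf_map_mul_gcd {Q : Type*} [Group Q] (φ : A →* Q) (x : A) :
    orderOf x = orderOf (φ x) * (orderOf x).gcd (Nat.card φ.ker) := by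
  let ψ := φ.comp (Subgroup.zpowers x).subtype
  have h₁ : ψ.ker = (powMonoidHom (Nat.card φ.ker) :
      Subgroup.zpowers x →* Subgroup.zpowers x).ker := by
    ext z
    rw [MonoidHom.mem_ker, MonoidHom.mem_ker, powMonoidHom_apply, ← Subtype.coe_inj]
    exact mem_iff_pow_card_eq_one φ.ker z.1
  have h₂ : ψ.range = Subgroup.zpowers (φ x) := by
    rw [MonoidHom.range_comp, Subgroup.range_subtype, MonoidHom.map_zpowers]
  have h := ψ.card_ker_mul_card_range
  rw [h₁, h₂, IsCyclic.card_powMonoidHom_ker, Nat.card_zpowers, Nat.card_zpowers] at h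
  rw [mul_comm]
  exact h.symm

/-- With k = ab as in `coprimePart_spec`, the power map x ↦ x^(ma) sends the coset to the subgroup C
of order b with constant fibers, and o(x) = ma · o(x^(ma)). The reduction ℤ/k → ℤ/b plays the same
role on the side of the weights. -/
theorem exists_equiv_cosetWeight {Q : Type*} [Group Q] (φ : A →* Q) (x₀ : A) {m k : ℕ}
    (hm : orderOf (φ x₀) = m) (hk : Nat.card φ.ker = k) :
    ∃ e : {x // φ x = φ x₀} ≃ ZMod k, ∀ x, orderOf x.1 = cosetWeight m k (e x) := by
  have hk0 : k ≠ 0 := hk ▸ Nat.card_pos.ne'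
  have hm0 : 0 < m := by
    rw [← hm]
    exact (φ.isOfFinOrder (isOfFinOrder_of_finite x₀)).orderOf_pos
  have : NeZero k := ⟨hk0⟩
  obtain ⟨a, j, hab, haj, hb⟩ := coprimePart_spec (m := m) hk0
  unfold cosetWeight
  have hbk := coprimePart_dvd (m := m) hk0
  generalize coprimePart m k = b at *
  have hb0 : 0 < b := Nat.pos_of_ne_zero (ne_zero_of_dvd_ne_zero hk0 hbk)
  have ha0 : 0 < a := Nat.pos_of_ne_zero (by rintro rfl; simp at hab; exact hk0 hab)
  let C : Subgroup A := (powMonoidHom b : A →* A).ker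
  have hbA : b ∣ Nat.card A := by
    refine hbk.trans ?_
    rw [← hk]
    exact Subgroup.card_subgroup_dvd_card _
  have hC : Nat.card C = b := by
    change Nat.card (powMonoidHom b : A →* A).ker = b
    rw [IsCyclic.card_powMonoidHom_ker, Nat.gcd_eq_right hbA]
  have hK : ∀ x, x ∈ φ.ker ↔ x ^ k = 1 := by
    intro x
    rw [← hk]
    exact mem_iff_pow_card_eq_one _ x
  have hmem : ∀ x : A, (φ x) ^ m = 1 → x ^ (m * a) ∈ C := by
    intro x hx
    change (x ^ (m * a)) ^ b = 1
    rw [← pow_mul, mul_assoc, ← hab, pow_mul]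
    exact (hK _).1 (by rw [MonoidHom.mem_ker, map_pow, hx])
  let P : φ.ker →* C := ((powMonoidHom (m * a)).comp φ.ker.subtype).codRestrict C fun z =>
    hmem z.1 (by rw [MonoidHom.mem_ker.1 z.2, one_pow])
  have hP : Function.Surjective P := by
    rw [← MonoidHom.range_eq_top]
    apply Subgroup.eq_top_of_card_eq
    have h₁ : P.ker = (powMonoidHom (m * a) : φ.ker →* φ.ker).ker := by
      ext z
      rw [MonoidHom.mem_ker, MonoidHom.mem_ker, ← Subtype.coe_inj, ← Subtype.coe_inj]
      rfl
    have h := P.card_ker_mul_card_range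
    -- Since gcd(ab, ma) = a · gcd(b, m), the power map on the kernel has a kernel of order a, hence
    -- an image of order b.
    have h₂ : k.gcd (m * a) = a := by
      rw [hab, mul_comm a b, Nat.gcd_mul_right, hb, one_mul]
    rw [h₁, IsCyclic.card_powMonoidHom_ker, hk, h₂, hab] at h
    rw [hC]
    exact Nat.eq_of_mul_eq_mul_left ha0 h
  have hpow : ∀ x : {x // φ x = φ x₀}, (φ x.1) ^ m = 1 := fun x => by
    rw [x.2, ← hm, pow_orderOf_eq_one]
  let f : {x // φ x = φ x₀} → C := fun x => ⟨x.1 ^ (m * a), hmem _ (hpow x)⟩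
  have hf : ConstFibers f := by
    refine ConstFibers.of_moves fun c d => ?_
    obtain ⟨z, hz⟩ := hP (c⁻¹ * d)
    refine ⟨fun x => ⟨x.1 * z.1, by rw [map_mul, MonoidHom.mem_ker.1 z.2, mul_one, x.2]⟩, ?_, ?_⟩
    · intro x y hxy
      exact Subtype.ext (mul_left_injective z.1 (congrArg Subtype.val hxy))
    · rintro x rfl
      apply Subtype.ext
      have hz' : z.1 ^ (m * a) = (x.1 ^ (m * a))⁻¹ * d.1 := congrArg Subtype.val hz
      change (x.1 * z.1) ^ (m * a) = d.1
      rw [mul_pow, hz', mul_inv_cancel_left]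
  obtain ⟨e, he⟩ := exists_equiv_zmod_orderOf hC
  have : NeZero b := ⟨hb0.ne'⟩
  obtain ⟨E, hE⟩ := hf.exists_equiv (ConstFibers.zmodCast hbk)
    (by rw [φ.card_fiber, hk, Nat.card_zmod]) e
  refine ⟨E, fun x => ?_⟩
  have h₁ : b.gcd (E x).val = b.gcd (e (f x)).val := by
    rw [← hE, val_castHom, gcd_mod_of_dvd dvd_rfl]
  have h₂ : m * a ∣ orderOf x.1 := by
    have h := orderOf_eq_orderOf_map_mul_gcd φ x.1
    rw [x.2, hm, hk] at h
    have hg0 : 0 < (orderOf x.1).gcd k := Nat.gcd_pos_of_pos_right _ (Nat.pos_of_ne_zero hk0)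
    obtain ⟨s, hs⟩ := Nat.gcd_dvd_right (orderOf x.1) k
    rw [h]
    refine Nat.mul_dvd_mul_left m ?_
    -- Put g = gcd(o(x), k), so o(x) = mg and k = gs. Then g = gcd(mg, gs) forces gcd(m, s) = 1; as
    -- a divides a power of m and a ∣ gs, it divides g.
    have hcop : m.Coprime s := by
      have hg : (m * (orderOf x.1).gcd k).gcd ((orderOf x.1).gcd k * s) =
          (orderOf x.1).gcd k := by rw [← h, ← hs]
      rw [mul_comm m, Nat.gcd_mul_left] at hg
      exact Nat.eq_of_mul_eq_mul_left hg0 (hg.trans (mul_one _).symm)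
    refine (coprime_of_dvd_pow haj hcop.symm).dvd_of_dvd_mul_right ?_
    rw [← hs]
    exact Dvd.intro b hab.symm
  have h₃ : orderOf (x.1 ^ (m * a)) = b / b.gcd (e (f x)).val := by
    rw [← he]
    exact Subgroup.orderOf_coe (f x)
  rw [orderOf_pow_of_dvd (Nat.mul_pos hm0 ha0).ne' h₂] at h₃
  rw [← Nat.mul_div_cancel' h₂, h₃, h₁, hab, Nat.mul_div_assoc _ (Nat.gcd_dvd_left _ _), mul_assoc]

end CyclicCosets

/-! ### Fiber domination and its composition -/

section FiberDom

/-- The fiber of `φ` over `q` admits an order-divisibility bijection onto a coset of a cyclic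
group. -/
def FiberDom {G Q : Type*} [Group G] [Group Q] (φ : G →* Q) (q : Q) : Prop :=
  WeightDom (fun x : {x // φ x = q} => orderOf x.1)
    (cosetWeight (orderOf q) (Nat.card φ.ker))

/-- Reduction of the multiplicative cyclic group of order `n` to that of order `d`. -/
def zmodReduction {n d : ℕ} (h : d ∣ n) : Multiplicative (ZMod n) →* Multiplicative (ZMod d) :=
  AddMonoidHom.toMultiplicative (ZMod.castHom h (ZMod d)).toAddMonoidHom

theorem zmodReduction_surjective {n d : ℕ} (h : d ∣ n) :
    Function.Surjective (zmodReduction h) := by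
  intro x
  obtain ⟨y, hy⟩ := ZMod.castHom_surjective h x.toAdd
  exact ⟨Multiplicative.ofAdd y, congrArg Multiplicative.ofAdd hy⟩

theorem card_ker_of_surjective {G Q : Type*} [Group G] [Group Q] {φ : G →* Q}
    (hφ : Function.Surjective φ) : Nat.card φ.ker * Nat.card Q = Nat.card G := by
  rw [← φ.card_ker_mul_card_range, MonoidHom.range_eq_top.2 hφ,
    Nat.card_congr Subgroup.topEquiv.toEquiv]

theorem card_ker_zmodReduction {l d : ℕ} (hd : d ≠ 0) (h : d ∣ d * l) :
    Nat.card (zmodReduction h).ker = l := by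
  have h₁ := card_ker_of_surjective (zmodReduction_surjective h)
  have h₂ : ∀ n, Nat.card (Multiplicative (ZMod n)) = n := Nat.card_zmod
  rw [h₂, h₂] at h₁
  exact Nat.eq_of_mul_eq_mul_right (Nat.pos_of_ne_zero hd) (h₁.trans (mul_comm d l))

theorem WeightDom.cosetWeight_of_dvd {m m₁ k : ℕ} (hk : k ≠ 0) (h : m₁ ∣ m) :
    WeightDom (cosetWeight m₁ k) (cosetWeight m k) := by
  have : NeZero k := ⟨hk⟩
  refine ⟨Equiv.refl _, fun i => ?_⟩
  have h₁ := mul_cosetWeight_dvd (t := 1) ((one_mul m₁).symm ▸ h) (dvd_refl k) i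
  rw [one_mul] at h₁
  simpa using h₁

theorem weightDom_fiber_cosetWeight {A Q : Type*} [CommGroup A] [Finite A] [IsCyclic A] [Group Q]
    {φ : A →* Q} (hφ : Function.Surjective φ) (q : Q) {m k : ℕ} (hm : orderOf q = m)
    (hk : Nat.card φ.ker = k) :
    WeightDom (fun x : {x // φ x = q} => orderOf x.1) (cosetWeight m k) ∧
      WeightDom (cosetWeight m k) (fun x : {x // φ x = q} => orderOf x.1) := by
  obtain ⟨x₀, rfl⟩ := hφ q
  obtain ⟨e, he⟩ := exists_equiv_cosetWeight φ x₀ hm hk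
  refine ⟨⟨e, fun x => (he x).dvd⟩, ⟨e.symm, fun i => ?_⟩⟩
  change _ ∣ orderOf (e.symm i).1
  rw [he (e.symm i), e.apply_symm_apply]

/-- The tower G → Q₁ → Q is compared with ℤ/mkl → ℤ/mk → ℤ/m. Match the middle fibers first; the
order of a middle element divides that of its partner, so monotonicity of `cosetWeight` in m lets
the upper fibers be matched over each such pair. -/
theorem FiberDom.comp {G Q₁ Q : Type*} [Group G] [Finite G] [Group Q₁] [Group Q]
    {φ : G →* Q₁} {ψ : Q₁ →* Q} (hφ : Function.Surjective φ) {q : Q} (hq : IsOfFinOrder q)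
    (hψq : FiberDom ψ q) (hφq : ∀ q₁, ψ q₁ = q → FiberDom φ q₁) : FiberDom (ψ.comp φ) q := by
  have : Finite Q₁ := Finite.of_surjective φ hφ
  obtain ⟨m, hm⟩ : ∃ m, orderOf q = m := ⟨_, rfl⟩
  obtain ⟨l, hl⟩ : ∃ l, Nat.card φ.ker = l := ⟨_, rfl⟩
  obtain ⟨k, hk⟩ : ∃ k, Nat.card ψ.ker = k := ⟨_, rfl⟩
  have hm0 : m ≠ 0 := by rw [← hm]; exact hq.orderOf_pos.ne'
  have hl0 : l ≠ 0 := by rw [← hl]; exact Nat.card_pos.ne'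
  have hk0 : k ≠ 0 := by rw [← hk]; exact Nat.card_pos.ne'
  have hkl : Nat.card (ψ.comp φ).ker = k * l := by
    let ρ : (ψ.comp φ).ker →* ψ.ker :=
      (φ.comp (ψ.comp φ).ker.subtype).codRestrict ψ.ker fun x => x.2
    have hρ : Function.Surjective ρ := by
      intro y
      obtain ⟨x, hx⟩ := hφ y.1
      refine ⟨⟨x, ?_⟩, Subtype.ext hx⟩
      rw [MonoidHom.mem_ker, MonoidHom.comp_apply, hx]
      exact y.2
    have h := card_ker_of_surjective hρ
    have h₂ : Nat.card ρ.ker = Nat.card φ.ker := by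
      refine Nat.card_congr ⟨fun x => ⟨x.1.1, congrArg Subtype.val x.2⟩,
        fun x => ⟨⟨x.1, ?_⟩, ?_⟩, fun _ => rfl, fun _ => rfl⟩
      · rw [MonoidHom.mem_ker, MonoidHom.comp_apply, MonoidHom.mem_ker.1 x.2, map_one]
      · exact Subtype.ext x.2
    rw [← h, h₂, hl, hk, mul_comm]
  have : NeZero m := ⟨hm0⟩
  have : NeZero (m * k) := ⟨mul_ne_zero hm0 hk0⟩
  have : NeZero (m * k * l) := ⟨mul_ne_zero (mul_ne_zero hm0 hk0) hl0⟩
  let f := zmodReduction (Dvd.intro l rfl : m * k ∣ m * k * l)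
  let g := zmodReduction (Dvd.intro k rfl : m ∣ m * k)
  have hf : Function.Surjective f := zmodReduction_surjective _
  have hg : Function.Surjective g := zmodReduction_surjective _
  have hfl : Nat.card f.ker = l := card_ker_zmodReduction (mul_ne_zero hm0 hk0) _
  have hgk : Nat.card g.ker = k := card_ker_zmodReduction hm0 _
  have hgfkl : Nat.card (g.comp f).ker = k * l := by
    have h := card_ker_of_surjective (φ := g.comp f) (hg.comp hf)
    have h₂ : ∀ n, Nat.card (Multiplicative (ZMod n)) = n := Nat.card_zmod
    rw [h₂, h₂] at h
    exact Nat.eq_of_mul_eq_mul_right (Nat.pos_of_ne_zero hm0) (h.trans (by ring))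
  let c : Multiplicative (ZMod m) := Multiplicative.ofAdd 1
  have hc : orderOf c = m := by
    rw [orderOf_ofAdd_eq_addOrderOf, ZMod.addOrderOf_one]
  unfold FiberDom at *
  rw [hm, hk] at hψq
  rw [hm, hkl]
  refine WeightDom.trans ?_ (weightDom_fiber_cosetWeight (φ := g.comp f) (hg.comp hf) c hc hgfkl).1
  obtain ⟨e, he⟩ := hψq.trans (weightDom_fiber_cosetWeight hg c hc hgk).2
  refine WeightDom.of_fibers (fun x : {x // ψ.comp φ x = q} => (⟨φ x.1, x.2⟩ : {y // ψ y = q}))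
    (fun x : {x // g.comp f x = c} => (⟨f x.1, x.2⟩ : {y // g y = c})) e fun y => ?_
  have h₁ := hφq y.1 y.2
  rw [hl] at h₁
  obtain ⟨E, hE⟩ := (h₁.trans (WeightDom.cosetWeight_of_dvd hl0 (he y))).trans
    (weightDom_fiber_cosetWeight hf (e y).1 rfl hfl).2
  refine ⟨⟨fun x => ⟨⟨(E ⟨x.1.1, congrArg Subtype.val x.2⟩).1, ?_⟩, ?_⟩,
    fun x => ⟨⟨(E.symm ⟨x.1.1, congrArg Subtype.val x.2⟩).1, ?_⟩, ?_⟩, ?_, ?_⟩, ?_⟩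
  · rw [MonoidHom.comp_apply, (E _).2]
    exact (e y).2
  · exact Subtype.ext (E _).2
  · rw [MonoidHom.comp_apply, (E.symm _).2]
    exact y.2
  · exact Subtype.ext (E.symm _).2
  · intro x
    simp
  · intro x
    simp
  · intro x
    exact hE _

end FiberDom

/-! ### Subgroup, trivial-kernel and prime-exponent cases -/

section FiberDomCases

variable {G Q : Type*} [Group G] [Group Q]

theorem FiberDom.of_equiv {G' Q' : Type*} [Group G'] [Group Q'] {φ : G →* Q} {φ' : G' →* Q'}
    {q : Q} {q' : Q'} (h : FiberDom φ' q') (E : {x // φ x = q} ≃ {x // φ' x = q'})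
    (hE : ∀ x, orderOf (E x).1 = orderOf x.1) (hq : orderOf q' = orderOf q)
    (hk : Nat.card φ'.ker = Nat.card φ.ker) : FiberDom φ q := by
  unfold FiberDom at *
  rw [hq, hk] at h
  exact WeightDom.trans ⟨E, fun x => (hE x).symm.dvd⟩ h

theorem FiberDom.of_subgroupComap {φ : G →* Q} {q : Q}
    (h : FiberDom (φ.subgroupComap (Subgroup.zpowers q))
      (⟨q, Subgroup.mem_zpowers q⟩ : Subgroup.zpowers q)) : FiberDom φ q := by
  refine h.of_equiv
    ⟨fun x => ⟨⟨x.1, ?_⟩, Subtype.ext x.2⟩, fun x => ⟨x.1.1, congrArg Subtype.val x.2⟩,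
      fun _ => rfl, fun _ => rfl⟩ (fun x => ?_) ?_ ?_
  · rw [Subgroup.mem_comap, x.2]
    exact Subgroup.mem_zpowers q
  · exact Subgroup.orderOf_mk _ _
  · exact Subgroup.orderOf_mk _ _
  · refine Nat.card_congr ⟨fun x => ⟨x.1.1, congrArg Subtype.val x.2⟩,
      fun x => ⟨⟨x.1, ?_⟩, Subtype.ext x.2⟩, fun _ => rfl, fun _ => rfl⟩
    rw [Subgroup.mem_comap, MonoidHom.mem_ker.1 x.2]
    exact one_mem _

theorem exists_fiber_equiv_zmod [Finite G] (φ : G →* Q) (y : G) :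
    Nonempty ({x // φ x = φ y} ≃ ZMod (Nat.card φ.ker)) := by
  have : NeZero (Nat.card φ.ker) := ⟨Nat.card_pos.ne'⟩
  exact Finite.card_eq.1 (by rw [φ.card_fiber, Nat.card_zmod])

theorem FiberDom.of_ker_eq_bot [Finite G] {φ : G →* Q} (h : φ.ker = ⊥) (y : G) :
    FiberDom φ (φ y) := by
  obtain ⟨e⟩ := exists_fiber_equiv_zmod φ y
  refine ⟨e, fun x => ?_⟩
  have hx : orderOf x.1 = orderOf (φ y) :=
    (orderOf_injective φ (φ.ker_eq_bot_iff.1 h) x.1).symm.trans (congrArg orderOf x.2)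
  exact hx.dvd.trans (dvd_cosetWeight _ _ _)

theorem pow_orderOf_map_mem_ker (φ : G →* Q) (x : G) : x ^ orderOf (φ x) ∈ φ.ker := by
  rw [MonoidHom.mem_ker, map_pow, pow_orderOf_eq_one]

theorem Nat.Prime.dvd_pow_div_gcd {p r v : ℕ} (hp : p.Prime) (hv : v ≠ 0) (hvr : v < p ^ r) :
    p ∣ p ^ r / (p ^ r).gcd v := by
  obtain ⟨u, -, hu⟩ := (Nat.dvd_prime_pow hp).1 (Nat.div_dvd_of_dvd (Nat.gcd_dvd_left (p ^ r) v))
  rw [hu]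
  refine dvd_pow_self p ?_
  rintro rfl
  rw [pow_zero] at hu
  have h := Nat.eq_of_dvd_of_div_eq_one (Nat.gcd_dvd_left (p ^ r) v) hu
  exact hv (Nat.eq_zero_of_dvd_of_lt (h ▸ Nat.gcd_dvd_right (p ^ r) v) hvr)

/-- Let m = o(φ y) and |ker φ| = p^r. All orders in the fiber divide mp. If p ∣ m, every weight is
m·p^r. Otherwise only the weight at index 0 can fail to be a multiple of mp, so the fiber needs one
element of order dividing m: a suitable power of y. -/
theorem FiberDom.of_forall_pow_prime_eq_one [Finite G] {φ : G →* Q} {p : ℕ} (hp : p.Prime)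
    (h : ∀ z ∈ φ.ker, z ^ p = 1) (y : G) : FiberDom φ (φ y) := by
  by_cases hbot : φ.ker = ⊥
  · exact FiberDom.of_ker_eq_bot hbot y
  have : Fact p.Prime := ⟨hp⟩
  obtain ⟨r, hr⟩ : ∃ r, Nat.card φ.ker = p ^ r :=
    IsPGroup.iff_card.1 fun z => ⟨1, by
      rw [pow_one]
      exact Subtype.ext (h z.1 z.2)⟩
  have hr0 : r ≠ 0 := by
    rintro rfl
    exact hbot (Subgroup.eq_bot_of_card_eq _ hr)
  obtain ⟨e⟩ := exists_fiber_equiv_zmod φ y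
  have hx : ∀ x : {x // φ x = φ y}, orderOf x.1 ∣ orderOf (φ y) * p := by
    intro x
    have h₁ := h _ (pow_orderOf_map_mem_ker φ x.1)
    rw [x.2, ← pow_mul] at h₁
    exact orderOf_dvd_of_pow_eq_one h₁
  unfold FiberDom
  rw [hr] at e ⊢
  have hk0 : p ^ r ≠ 0 := pow_ne_zero r hp.ne_zero
  have : NeZero (p ^ r) := ⟨hk0⟩
  obtain ⟨a, j, hab, haj, hb⟩ := coprimePart_spec (m := orderOf (φ y)) hk0
  by_cases hpm : p ∣ orderOf (φ y)
  · have h₁ : coprimePart (orderOf (φ y)) (p ^ r) = 1 :=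
      (Nat.Coprime.pow_right r (hb.coprime_dvd_right hpm)).eq_one_of_dvd (coprimePart_dvd hk0)
    refine ⟨e, fun x => (hx x).trans ?_⟩
    rw [cosetWeight, h₁, Nat.gcd_one_left, Nat.div_one]
    exact Nat.mul_dvd_mul_left _ (dvd_pow_self p hr0)
  · have hcop : (orderOf (φ y)).Coprime p := ((hp.coprime_iff_not_dvd).2 hpm).symm
    have ha : a = 1 := Nat.Coprime.eq_one_of_dvd
      (Nat.Coprime.pow_right r (coprime_of_dvd_pow haj hcop.symm)) (Dvd.intro _ hab.symm)
    have h₁ : coprimePart (orderOf (φ y)) (p ^ r) = p ^ r := by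
      rw [ha, one_mul] at hab
      exact hab.symm
    -- s ≡ 1 mod m keeps y^s in the fiber, and p ∣ s makes its order divide m.
    obtain ⟨s, hs₁, hs₀⟩ := Nat.chineseRemainder hcop 1 0
    have hx₀ : φ (y ^ s) = φ y := by
      rw [map_pow]
      conv_rhs => rw [← pow_one (φ y)]
      exact pow_eq_pow_iff_modEq.2 hs₁
    have hx₀' : orderOf (y ^ s) ∣ orderOf (φ y) := by
      obtain ⟨s', rfl⟩ := (Nat.modEq_zero_iff_dvd).1 hs₀
      apply orderOf_dvd_of_pow_eq_one
      rw [← pow_mul, mul_comm, ← mul_assoc, pow_mul]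
      rw [orderOf_dvd_iff_pow_eq_one.1 (hx ⟨y, rfl⟩), one_pow]
    -- Any bijection serves once y^s is moved to the exceptional index 0.
    refine ⟨e.trans (Equiv.swap (e ⟨y ^ s, hx₀⟩) 0), fun x => ?_⟩
    by_cases hxx : x = ⟨y ^ s, hx₀⟩
    · rw [hxx]
      exact hx₀'.trans (dvd_cosetWeight _ _ _)
    · refine (hx x).trans ?_
      have hi : (e.trans (Equiv.swap (e ⟨y ^ s, hx₀⟩) 0)) x ≠ 0 := by
        intro h0
        apply hxx
        apply (e.trans (Equiv.swap (e ⟨y ^ s, hx₀⟩) 0)).injective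
        rw [h0]
        simp
      generalize (e.trans (Equiv.swap (e ⟨y ^ s, hx₀⟩) 0)) x = i at hi
      rw [cosetWeight, h₁]
      refine Nat.mul_dvd_mul_left _ ?_
      exact hp.dvd_pow_div_gcd (fun h0 => hi ((ZMod.val_eq_zero i).1 h0)) i.val_lt

/-- For a prime p dividing |N|, the solutions of z^p = 1 in N form a normal subgroup of G,
nontrivial by Cauchy, hence all of N. -/
theorem IsMinimalNormal.exists_prime_pow_eq_one [Finite G] {N : Subgroup G}
    (hN : IsMinimalNormal N) (hc : ∀ a ∈ N, ∀ b ∈ N, a * b = b * a) :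
    ∃ p : ℕ, p.Prime ∧ ∀ z ∈ N, z ^ p = 1 := by
  have hN1 : Nat.card N ≠ 1 := fun h => hN.prop.2 (Subgroup.eq_bot_of_card_eq _ h)
  obtain ⟨p, hp, hpN⟩ := Nat.exists_prime_and_dvd hN1
  have : Fact p.Prime := ⟨hp⟩
  refine ⟨p, hp, ?_⟩
  let T : Subgroup G :=
    { carrier := {z | z ∈ N ∧ z ^ p = 1}
      one_mem' := ⟨one_mem _, one_pow _⟩
      mul_mem' := fun {a b} ha hb => ⟨mul_mem ha.1 hb.1, by
        rw [(show Commute a b from hc a ha.1 b hb.1).mul_pow, ha.2, hb.2, one_mul]⟩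
      inv_mem' := fun {a} ha => ⟨inv_mem ha.1, by rw [inv_pow, ha.2, inv_one]⟩ }
  have hT : T.Normal := ⟨fun z hz g => ⟨hN.prop.1.conj_mem z hz.1 g, by
    rw [conj_pow, hz.2, mul_one, mul_inv_cancel]⟩⟩
  have hT0 : T ≠ ⊥ := by
    obtain ⟨x, hx⟩ := exists_prime_orderOf_dvd_card' p hpN
    intro hbot
    have hxT : x.1 ∈ T := ⟨x.2, by
      rw [← hx, ← Subgroup.orderOf_coe, pow_orderOf_eq_one]⟩
    rw [hbot, Subgroup.mem_bot] at hxT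
    rw [← Subgroup.orderOf_coe, hxT, orderOf_one] at hx
    exact hp.one_lt.ne hx
  intro z hz
  exact (hN.le_of_le ⟨hT, hT0⟩ (fun z hz => hz.1) hz).2

end FiberDomCases

/-! ### Structure of non-abelian minimal normal subgroups -/

section MinimalNormal

variable {G : Type*} [Group G] {N M : Subgroup G}

theorem le_normalizer_of_conj_mem {K L : Subgroup G}
    (h : ∀ g ∈ K, ∀ x ∈ L, g * x * g⁻¹ ∈ L) : K ≤ Subgroup.normalizer (L : Set G) := by
  intro g hg
  rw [Subgroup.mem_normalizer_iff]
  refine fun x => ⟨h g hg x, fun hx => ?_⟩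
  have h₁ := h g⁻¹ (inv_mem hg) _ hx
  simpa [mul_assoc] using h₁

theorem conj_mem_of_mem_normalizer {L : Subgroup G} {g x : G}
    (hg : g ∈ Subgroup.normalizer (L : Set G)) (hx : x ∈ L) : g * x * g⁻¹ ∈ L :=
  (Subgroup.mem_normalizer_iff.1 hg x).1 hx

/-- `M` is minimal among the nontrivial subgroups of `N` that are normalized by `N`. -/
def IsMinimalNormalIn (M N : Subgroup G) : Prop :=
  Minimal (fun K : Subgroup G => K ≤ N ∧ N ≤ Subgroup.normalizer (K : Set G) ∧ K ≠ ⊥) M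

theorem exists_isMinimalNormalIn [Finite G] (hN : N ≠ ⊥) : ∃ M, IsMinimalNormalIn M N := by
  obtain ⟨M, -, hM⟩ := exists_minimal_le_of_wellFoundedLT
    (fun K : Subgroup G => K ≤ N ∧ N ≤ Subgroup.normalizer (K : Set G) ∧ K ≠ ⊥) N
    ⟨le_rfl, Subgroup.le_normalizer, hN⟩
  exact ⟨M, hM⟩

/-- A conjugate of M other than M is also normalized by N, so by minimality it meets M trivially;
commutators between the two lie in the intersection. -/
theorem IsMinimalNormalIn.commute_conj [Finite G] (hM : IsMinimalNormalIn M N) (hN : N.Normal) {g a b : G}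
    (hg : g ∉ Subgroup.normalizer (M : Set G)) (ha : a ∈ M) (hb : b ∈ M) :
    Commute a (g * b * g⁻¹) := by
  obtain ⟨hMN, hNM, hM0⟩ := hM.prop
  let M' := M.map (MulAut.conj g).toMonoidHom
  have hmem : ∀ x ∈ M, g * x * g⁻¹ ∈ M' := fun x hx => ⟨x, hx, rfl⟩
  have hM' : ∀ h ∈ N, ∀ x ∈ M', h * x * h⁻¹ ∈ M' := by
    rintro h hh _ ⟨x, hx, rfl⟩
    have h₁ : g⁻¹ * h * g ∈ N := by
      have := hN.conj_mem h hh g⁻¹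
      rwa [inv_inv] at this
    have h₂ := hmem _ (conj_mem_of_mem_normalizer (hNM h₁) hx)
    convert h₂ using 1
    simp only [MulEquiv.coe_toMonoidHom, MulAut.conj_apply]
    group
  have hT : M ⊓ M' = ⊥ := by
    by_contra hT
    have hle : M ≤ M ⊓ M' := hM.le_of_le ⟨inf_le_left.trans hMN, le_normalizer_of_conj_mem
      fun h hh x hx => ⟨conj_mem_of_mem_normalizer (hNM hh) hx.1, hM' h hh x hx.2⟩, hT⟩ inf_le_left
    have heq : M = M' := Subgroup.eq_of_le_of_card_ge (hle.trans inf_le_right)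
      (Nat.card_congr (M.equivMapOfInjective _ (MulAut.conj g).injective).toEquiv).symm.le
    apply hg
    rw [Subgroup.mem_normalizer_iff]
    refine fun x => ⟨fun hx => ?_, fun hx => ?_⟩
    · rw [heq]
      exact hmem x hx
    · rw [heq] at hx
      obtain ⟨z, hz, hzx⟩ := hx
      have : z = x := by
        simpa using hzx
      exact this ▸ hz
  have hc := hmem b hb
  have hcN : g * b * g⁻¹ ∈ N := hN.conj_mem b (hMN hb) g
  generalize g * b * g⁻¹ = c at hc hcN
  have h₁ : a * c * a⁻¹ * c⁻¹ ∈ M ⊓ M' := by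
    refine Subgroup.mem_inf.2 ⟨?_, mul_mem (hM' a (hMN ha) c hc) (inv_mem hc)⟩
    have := mul_mem ha (conj_mem_of_mem_normalizer (hNM hcN) (inv_mem ha))
    simpa [mul_assoc] using this
  rw [hT, Subgroup.mem_bot, mul_inv_eq_one, mul_inv_eq_iff_eq_mul] at h₁
  exact h₁

theorem IsMinimalNormalIn.le_of_conj_mem (hM : IsMinimalNormalIn M N) (hN : IsMinimalNormal N)
    {T : Subgroup G} (h : ∀ g, ∀ a ∈ M, g * a * g⁻¹ ∈ T) : N ≤ T := by
  have h₁ : N ≤ Subgroup.normalClosure (M : Set G) := by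
    have := hN.prop.1
    refine hN.le_of_le ⟨Subgroup.normalClosure_normal, fun h0 => hM.prop.2.2 ?_⟩
      (Subgroup.normalClosure_le_normal hM.prop.1)
    rw [eq_bot_iff, ← h0]
    exact Subgroup.subset_normalClosure
  refine h₁.trans ((Subgroup.closure_le T).2 fun x hx => ?_)
  obtain ⟨a, ha, hax⟩ := Group.mem_conjugatesOfSet_iff.1 hx
  obtain ⟨g, rfl⟩ := isConj_iff.1 hax
  exact h g a ha

/-- N is generated by the conjugates of M, each of which equals M or centralizes it. Hence N acts on
M through inner automorphisms. -/
theorem IsMinimalNormalIn.le_sup_centralizer [Finite G] (hM : IsMinimalNormalIn M N)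
    (hN : IsMinimalNormal N) : N ≤ M ⊔ Subgroup.centralizer (M : Set G) := by
  refine hM.le_of_conj_mem hN fun g a ha => ?_
  by_cases hg : g ∈ Subgroup.normalizer (M : Set G)
  · exact Subgroup.mem_sup_left (conj_mem_of_mem_normalizer hg ha)
  · refine Subgroup.mem_sup_right (Subgroup.mem_centralizer_iff.2 fun b hb => ?_)
    exact hM.commute_conj hN.prop.1 hg hb ha

theorem IsMinimalNormal.inf_centralizer (hN : IsMinimalNormal N)
    (hc : ¬ ∀ a ∈ N, ∀ b ∈ N, a * b = b * a) : N ⊓ Subgroup.centralizer (N : Set G) = ⊥ := by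
  by_contra h0
  have := hN.prop.1
  have hle : N ≤ N ⊓ Subgroup.centralizer (N : Set G) :=
    hN.le_of_le ⟨inferInstance, h0⟩ inf_le_left
  exact hc fun a ha b hb => Subgroup.mem_centralizer_iff.1 (hle hb).2 a ha

/-- A nontrivial center of M would be all of M by minimality. Then N ≤ M·C(M) = C(M), putting M in
the center of N, which is trivial. -/
theorem IsMinimalNormalIn.inf_centralizer [Finite G] (hM : IsMinimalNormalIn M N) (hN : IsMinimalNormal N)
    (hc : ¬ ∀ a ∈ N, ∀ b ∈ N, a * b = b * a) : M ⊓ Subgroup.centralizer (M : Set G) = ⊥ := by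
  obtain ⟨hMN, hNM, hM0⟩ := hM.prop
  by_contra h0
  have hle : M ≤ M ⊓ Subgroup.centralizer (M : Set G) := by
    refine hM.le_of_le ⟨inf_le_left.trans hMN, le_normalizer_of_conj_mem fun g hg x hx =>
      Subgroup.mem_inf.2 ⟨conj_mem_of_mem_normalizer (hNM hg) hx.1, ?_⟩, h0⟩ inf_le_left
    rw [Subgroup.mem_centralizer_iff]
    intro b hb
    have hb' : g⁻¹ * b * g ∈ M := by
      have := conj_mem_of_mem_normalizer (inv_mem (hNM hg)) hb
      rwa [inv_inv] at this
    have h₁ := Subgroup.mem_centralizer_iff.1 hx.2 _ hb'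
    calc b * (g * x * g⁻¹) = g * ((g⁻¹ * b * g) * x) * g⁻¹ := by group
      _ = g * (x * (g⁻¹ * b * g)) * g⁻¹ := by rw [h₁]
      _ = g * x * g⁻¹ * b := by group
  have hNC : N ≤ Subgroup.centralizer (M : Set G) :=
    (hM.le_sup_centralizer hN).trans (sup_le (hle.trans inf_le_right) le_rfl)
  have hMC : M ≤ N ⊓ Subgroup.centralizer (N : Set G) := by
    refine le_inf hMN (Subgroup.le_centralizer_iff.1 hNC)
  rw [hN.inf_centralizer hc, le_bot_iff] at hMC
  exact hM0 hMC

end MinimalNormal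

/-! ### Reduction to the automorphisms induced on M -/

section NormalizerReduction

theorem exists_pos_pow_mem_iff_dvd {G : Type*} [Group G] [Finite G] (H : Subgroup G) (y : G) :
    ∃ t : ℕ, 0 < t ∧ ∀ j : ℕ, y ^ j ∈ H ↔ t ∣ j := by
  have h : ∀ j : ℕ, y ^ j ∈ H ↔
      -- The exponent t is the length of the orbit of the coset H under left multiplication by y.
      Function.minimalPeriod (fun x : G ⧸ H => y • x) ((1 : G) : G ⧸ H) ∣ j := by
    intro j
    rw [← MulAction.pow_smul_eq_iff_minimalPeriod_dvd, MulAction.Quotient.smul_mk, smul_eq_mul,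
      mul_one, eq_comm, QuotientGroup.eq, inv_one, one_mul]
  refine ⟨_, Nat.pos_of_ne_zero fun h0 => ?_, h⟩
  have h₁ := (h (orderOf y)).1 (by rw [pow_orderOf_eq_one]; exact one_mem H)
  rw [h0, zero_dvd_iff] at h₁
  exact (orderOf_pos y).ne' h₁

variable {G : Type*} [Group G]

/-- The group of automorphisms of `M` induced by the normalizer of `M`. -/
abbrev inducedAut (M : Subgroup G) : Subgroup (MulAut M) :=
  M.normalizerMonoidHom.range

/-- The action of the normalizer of `M` on `M`. -/
noncomputable abbrev toInducedAut (M : Subgroup G) :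
    Subgroup.normalizer (M : Set G) →* inducedAut M :=
  M.normalizerMonoidHom.rangeRestrict

/-- The group of automorphisms of `M` induced by `M`. -/
noncomputable abbrev innerAut (M : Subgroup G) : Subgroup (inducedAut M) :=
  (M.subgroupOf (Subgroup.normalizer (M : Set G))).map (toInducedAut M)

instance innerAut_normal (M : Subgroup G) : (innerAut M).Normal :=
  Subgroup.Normal.map inferInstance _ M.normalizerMonoidHom.rangeRestrict_surjective

theorem toInducedAut_eq_one_iff {M : Subgroup G} (x : Subgroup.normalizer (M : Set G)) :
    toInducedAut M x = 1 ↔ x.1 ∈ Subgroup.centralizer (M : Set G) := by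
  rw [← MonoidHom.mem_ker, MonoidHom.ker_rangeRestrict, Subgroup.normalizerMonoidHom_ker,
    Subgroup.mem_subgroupOf]

theorem card_innerAut {M : Subgroup G} (hM : M ⊓ Subgroup.centralizer (M : Set G) = ⊥) :
    Nat.card (innerAut M) = Nat.card M := by
  refine (Nat.card_congr (Equiv.ofBijective
    (fun s : M => (⟨toInducedAut M ⟨s.1, Subgroup.le_normalizer s.2⟩, ⟨_, s.2, rfl⟩⟩ :
      innerAut M)) ⟨fun s s' h => ?_, ?_⟩)).symm
  · have h₁ := congrArg Subtype.val h
    change toInducedAut M _ = toInducedAut M _ at h₁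
    rw [← inv_mul_eq_one, ← map_inv, ← map_mul, toInducedAut_eq_one_iff] at h₁
    have h₂ : s.1⁻¹ * s'.1 ∈ M ⊓ Subgroup.centralizer (M : Set G) :=
      Subgroup.mem_inf.2 ⟨mul_mem (inv_mem s.2) s'.2, h₁⟩
    rw [hM, Subgroup.mem_bot, inv_mul_eq_one] at h₂
    exact Subtype.ext h₂
  · rintro ⟨_, x, hx, rfl⟩
    exact ⟨⟨x.1, hx⟩, rfl⟩

variable {N M : Subgroup G}

theorem IsMinimalNormalIn.toInducedAut_mem [Finite G] (hM : IsMinimalNormalIn M N) (hN : IsMinimalNormal N)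
    {w : G} (hw : w ∈ N) :
    toInducedAut M ⟨w, hM.prop.2.1 hw⟩ ∈ innerAut M := by
  have h : N ≤ ((innerAut M).comap (toInducedAut M)).map
      (Subgroup.normalizer (M : Set G)).subtype := by
    refine (hM.le_sup_centralizer hN).trans (sup_le (fun s hs => ?_) fun s hs => ?_)
    · exact ⟨⟨s, Subgroup.le_normalizer hs⟩, ⟨_, hs, rfl⟩, rfl⟩
    · have hs' : s ∈ Subgroup.normalizer (M : Set G) := Subgroup.centralizer_le_normalizer _ hs
      refine ⟨⟨s, hs'⟩, ?_, rfl⟩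
      have h₁ := (toInducedAut_eq_one_iff ⟨s, hs'⟩).2 hs
      change toInducedAut M ⟨s, hs'⟩ ∈ innerAut M
      rw [h₁]
      exact one_mem _
  obtain ⟨x, hx, hxw⟩ := h hw
  have : x = ⟨w, hM.prop.2.1 hw⟩ := Subtype.ext hxw
  exact this ▸ hx

/-- Moving the powers of x to the left writes (xs)^(r+1) as x^(r+1) times the conjugates of s by
x^(-j), for j from r down to 0. For 0 < j < t these centralize M, so at r + 1 = t only the last
factor s acts on M. -/
theorem IsMinimalNormalIn.exists_mul_pow_eq [Finite G] (hM : IsMinimalNormalIn M N) (hN : IsMinimalNormal N)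
    {t : ℕ} {x s : G} (hs : s ∈ M)
    (hx : ∀ j : ℕ, x ^ j ∈ Subgroup.normalizer (M : Set G) ↔ t ∣ j) (r : ℕ) (hr : r + 1 ≤ t) :
    ∃ c ∈ Subgroup.centralizer (M : Set G), (x * s) ^ (r + 1) = x ^ (r + 1) * (c * s) := by
  induction r with
  | zero => exact ⟨1, one_mem _, by simp⟩
  | succ r ih =>
    obtain ⟨c, hc, h⟩ := ih (by omega)
    have hnot : (x ^ (r + 1))⁻¹ ∉ Subgroup.normalizer (M : Set G) := by
      rw [inv_mem_iff, hx]
      exact Nat.not_dvd_of_pos_of_lt (Nat.succ_pos r) (by omega)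
    refine ⟨(x ^ (r + 1))⁻¹ * s * (x ^ (r + 1))⁻¹⁻¹ * c, mul_mem ?_ hc, ?_⟩
    · rw [Subgroup.mem_centralizer_iff]
      exact fun b hb => hM.commute_conj hN.prop.1 hnot hb hs
    · rw [pow_succ', h, pow_succ' x (r + 1)]
      group

variable {Q : Type*} [Group Q] {φ : G →* Q}

/-- For L the lcm, x^L lies in N = ker φ and centralizes M. Since G = ⟨x⟩N and N normalizes M, every
conjugate of M is a conjugate by a power of x, so x^L centralizes them all, hence N, whose center is
trivial. -/
theorem IsMinimalNormalIn.orderOf_dvd_lcm (hM : IsMinimalNormalIn M φ.ker)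
    (hN : IsMinimalNormal φ.ker) (hc : ¬ ∀ a ∈ φ.ker, ∀ b ∈ φ.ker, a * b = b * a)
    {x : G} (hgen : Subgroup.zpowers (φ x) = ⊤)
    {t : ℕ} (ht : x ^ t ∈ Subgroup.normalizer (M : Set G)) :
    orderOf x ∣ (orderOf (φ x)).lcm (t * orderOf (toInducedAut M ⟨x ^ t, ht⟩)) := by
  obtain ⟨l, hl⟩ := Nat.dvd_lcm_right (orderOf (φ x)) (t * orderOf (toInducedAut M ⟨x ^ t, ht⟩))
  obtain ⟨l', hl'⟩ := Nat.dvd_lcm_left (orderOf (φ x)) (t * orderOf (toInducedAut M ⟨x ^ t, ht⟩))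
  generalize (orderOf (φ x)).lcm (t * orderOf (toInducedAut M ⟨x ^ t, ht⟩)) = L at hl hl'
  apply orderOf_dvd_of_pow_eq_one
  have h₁ : x ^ L ∈ φ.ker := by
    rw [hl', pow_mul]
    exact pow_mem (pow_orderOf_map_mem_ker φ x) _
  have h₂ : x ^ L ∈ Subgroup.centralizer (M : Set G) := by
    have h := (toInducedAut_eq_one_iff ((⟨x ^ t, ht⟩ : Subgroup.normalizer (M : Set G)) ^
      orderOf (toInducedAut M ⟨x ^ t, ht⟩))).1 (by rw [map_pow, pow_orderOf_eq_one])
    rw [hl, pow_mul, pow_mul]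
    exact pow_mem h _
  have h₃ : φ.ker ≤ Subgroup.centralizer {x ^ L} := by
    refine hM.le_of_conj_mem hN fun g a ha => ?_
    obtain ⟨j, hj⟩ : φ g ∈ Subgroup.zpowers (φ x) := hgen ▸ Subgroup.mem_top _
    have hh : (x ^ j)⁻¹ * g ∈ φ.ker := by
      rw [MonoidHom.mem_ker, map_mul, map_inv, map_zpow, ← hj]
      simp
    have hb := conj_mem_of_mem_normalizer (hM.prop.2.1 hh) ha
    have h₄ := Subgroup.mem_centralizer_iff.1 h₂ _ hb
    have h₅ : g * a * g⁻¹ = x ^ j * ((x ^ j)⁻¹ * g * a * ((x ^ j)⁻¹ * g)⁻¹) * (x ^ j)⁻¹ := by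
      group
    rw [h₅, Subgroup.mem_centralizer_singleton_iff]
    have h₆ : Commute (x ^ L) (x ^ j) := (Commute.refl x).pow_left L |>.zpow_right j
    exact ((h₆.mul_right (h₄.symm : Commute _ _)).mul_right h₆.inv_right).symm
  have h₇ : x ^ L ∈ φ.ker ⊓ Subgroup.centralizer (φ.ker : Set G) := by
    refine ⟨h₁, Subgroup.mem_centralizer_iff.2 fun b hb => ?_⟩
    exact Subgroup.mem_centralizer_singleton_iff.1 (h₃ hb)
  rwa [hN.inf_centralizer hc, Subgroup.mem_bot] at h₇

theorem FiberDom.of_inducedAut [Finite G] (hM : IsMinimalNormalIn M φ.ker) (hN : IsMinimalNormal φ.ker)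
    (hc : ¬ ∀ a ∈ φ.ker, ∀ b ∈ φ.ker, a * b = b * a) (y : G)
    (hgen : Subgroup.zpowers (φ y) = ⊤)
    (hB : ∀ q, FiberDom (QuotientGroup.mk' (innerAut M)) q) : FiberDom φ (φ y) := by
  obtain ⟨t, ht0, ht⟩ := exists_pos_pow_mem_iff_dvd (Subgroup.normalizer (M : Set G)) y
  have hdiv : ∀ x, φ x = φ y → ∀ j : ℕ, ∃ w ∈ φ.ker, x ^ j = y ^ j * w := fun x hx j =>
    ⟨(y ^ j)⁻¹ * x ^ j, by
      rw [MonoidHom.mem_ker, map_mul, map_inv, map_pow, map_pow, hx, inv_mul_cancel],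
      (mul_inv_cancel_left _ _).symm⟩
  have htx : ∀ x, φ x = φ y → ∀ j : ℕ, x ^ j ∈ Subgroup.normalizer (M : Set G) ↔ t ∣ j := by
    intro x hx j
    obtain ⟨w, hw, h⟩ := hdiv x hx j
    rw [h, ← ht j]
    exact Subgroup.mul_mem_cancel_right _ (hM.prop.2.1 hw)
  have htm : ∀ x, φ x = φ y → x ^ t ∈ Subgroup.normalizer (M : Set G) := fun x hx =>
    (htx x hx t).2 dvd_rfl
  let ψ := QuotientGroup.mk' (innerAut M)
  let q := ψ (toInducedAut M ⟨y ^ t, htm y rfl⟩)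
  have hmemq : ∀ x (hx : φ x = φ y), ψ (toInducedAut M ⟨x ^ t, htm x hx⟩) = q := by
    intro x hx
    obtain ⟨w, hw, h⟩ := hdiv x hx t
    have h₁ : (⟨x ^ t, htm x hx⟩ : Subgroup.normalizer (M : Set G)) =
        ⟨y ^ t, htm y rfl⟩ * ⟨w, hM.prop.2.1 hw⟩ := Subtype.ext h
    rw [h₁, map_mul, map_mul]
    have h₂ : ψ (toInducedAut M ⟨w, hM.prop.2.1 hw⟩) = 1 :=
      (QuotientGroup.eq_one_iff _).2 (hM.toInducedAut_mem hN hw)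
    rw [h₂, mul_one]
  let Φ : {x // φ x = φ y} → {β // ψ β = q} := fun x =>
    ⟨toInducedAut M ⟨x.1 ^ t, htm x.1 x.2⟩, hmemq x.1 x.2⟩
  -- Right multiplication of x by s ∈ M multiplies the action of x^t by that of s, and Inn(M) is
  -- transitive on its coset.
  have hΦ : ConstFibers Φ := by
    refine ConstFibers.of_moves fun c d => ?_
    have hcd : c.1⁻¹ * d.1 ∈ innerAut M := QuotientGroup.eq.1 (c.2.trans d.2.symm)
    obtain ⟨s, hs, hsd⟩ := hcd
    have hs : s.1 ∈ M := hs
    have hsker : φ s.1 = 1 := hM.prop.1 hs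
    have hxs : ∀ x : {x // φ x = φ y}, φ (x.1 * s.1) = φ y := fun x => by
      rw [map_mul, hsker, mul_one, x.2]
    refine ⟨fun x => ⟨x.1 * s.1, hxs x⟩, fun x x' h =>
      Subtype.ext (mul_left_injective s.1 (congrArg Subtype.val h)), ?_⟩
    rintro x rfl
    apply Subtype.ext
    obtain ⟨r, rfl⟩ : ∃ r, t = r + 1 := ⟨t - 1, by omega⟩
    obtain ⟨z, hz, hpow⟩ := hM.exists_mul_pow_eq hN hs (htx x.1 x.2) r le_rfl
    have hzN := Subgroup.centralizer_le_normalizer _ hz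
    have h₁ : (⟨(x.1 * s.1) ^ (r + 1), htm _ (hxs x)⟩ : Subgroup.normalizer (M : Set G)) =
        ⟨x.1 ^ (r + 1), htm x.1 x.2⟩ * (⟨z, hzN⟩ * s) := Subtype.ext hpow
    change toInducedAut M ⟨(x.1 * s.1) ^ (r + 1), htm _ (hxs x)⟩ = d.1
    rw [h₁, map_mul, map_mul, (toInducedAut_eq_one_iff ⟨z, hzN⟩).2 hz, one_mul, hsd]
    exact mul_inv_cancel_left _ _
  have hk : Nat.card ψ.ker = Nat.card M := by
    rw [QuotientGroup.ker_mk']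
    exact card_innerAut (hM.inf_centralizer hN hc)
  have hBq : FiberDom ψ q := hB q
  unfold FiberDom at hBq ⊢
  rw [hk] at hBq
  obtain ⟨e, he⟩ := hBq
  have : NeZero (Nat.card φ.ker) := ⟨Nat.card_pos.ne'⟩
  have : NeZero (Nat.card M) := ⟨Nat.card_pos.ne'⟩
  have hMN : Nat.card M ∣ Nat.card φ.ker := Subgroup.card_dvd_of_le hM.prop.1
  obtain ⟨E, hE⟩ := hΦ.exists_equiv (ConstFibers.zmodCast hMN)
    (by rw [φ.card_fiber, Nat.card_zmod]) e
  -- With m = o(φ y), y^m lies in N and so normalizes M. Thus m = tr, and q^r is the class of the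
  -- action of y^m, which is inner.
  have hm : t * orderOf q ∣ orderOf (φ y) := by
    have hyN := pow_orderOf_map_mem_ker φ y
    obtain ⟨r, hr⟩ := (ht _).1 (hM.prop.2.1 hyN)
    rw [hr]
    refine Nat.mul_dvd_mul_left t (orderOf_dvd_of_pow_eq_one ?_)
    rw [← map_pow, ← map_pow]
    refine (QuotientGroup.eq_one_iff _).2 ?_
    convert hM.toInducedAut_mem hN hyN using 2
    apply Subtype.ext
    change (y ^ t) ^ r = y ^ orderOf (φ y)
    rw [hr, pow_mul]
  refine ⟨E, fun x => ?_⟩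
  have h₁ := hM.orderOf_dvd_lcm hN hc (by rw [x.2]; exact hgen) (htm x.1 x.2)
  rw [x.2] at h₁
  refine h₁.trans (Nat.lcm_dvd (dvd_cosetWeight _ _ _) ?_)
  refine (Nat.mul_dvd_mul_left t (he (Φ x))).trans ?_
  rw [← hE]
  exact mul_cosetWeight_dvd hm hMN _

end NormalizerReduction

/-! ### Translation between coset bijections and fiber domination -/

section CosetBijection

variable {G : Type u} [Group G]

theorem mem_smul_subgroup_iff (N : Subgroup G) [N.Normal] (y z : G) :
    z ∈ y • (N : Set G) ↔ QuotientGroup.mk' N z = QuotientGroup.mk' N y := by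
  rw [Set.mem_smul_set_iff_inv_smul_mem, smul_eq_mul, eq_comm]
  exact QuotientGroup.eq.symm

theorem hasCosetBijection_iff (N : Subgroup G) [N.Normal] (y : G) (v : CyclicGrp (Nat.card G)) :
    HasCosetBijection N y v ↔
      WeightDom (fun x : {x // QuotientGroup.mk' N x = QuotientGroup.mk' N y} => orderOf x.1)
        (fun w : {w // QuotientGroup.mk' (cyclicSub (Nat.card G) (Nat.card N)) w =
          QuotientGroup.mk' (cyclicSub (Nat.card G) (Nat.card N)) v} => orderOf w.1) := by
  set C := cyclicSub (Nat.card G) (Nat.card N)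
  constructor
  · rintro ⟨f, hf, hd⟩
    let F : {x // QuotientGroup.mk' N x = QuotientGroup.mk' N y} →
        {w // QuotientGroup.mk' C w = QuotientGroup.mk' C v} := fun x =>
      ⟨f x.1, (mem_smul_subgroup_iff C v _).1 (hf.mapsTo ((mem_smul_subgroup_iff N y _).2 x.2))⟩
    have hF : F.Bijective := by
      constructor
      · intro a b hab
        exact Subtype.ext (hf.injOn ((mem_smul_subgroup_iff N y _).2 a.2)
          ((mem_smul_subgroup_iff N y _).2 b.2) (congrArg Subtype.val hab))
      · rintro ⟨w, hw⟩
        obtain ⟨x, hx, rfl⟩ := hf.surjOn ((mem_smul_subgroup_iff C v _).2 hw)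
        exact ⟨⟨x, (mem_smul_subgroup_iff N y _).1 hx⟩, rfl⟩
    refine ⟨Equiv.ofBijective F hF, fun x => ?_⟩
    have h := hd (y⁻¹ * x.1) (QuotientGroup.eq.1 x.2.symm)
    rwa [mul_inv_cancel_left] at h
  · rintro ⟨e, he⟩
    classical
    let f : G → CyclicGrp (Nat.card G) := fun x =>
      if h : QuotientGroup.mk' N x = QuotientGroup.mk' N y then (e ⟨x, h⟩).1 else 1
    have hf : ∀ x : {x // QuotientGroup.mk' N x = QuotientGroup.mk' N y}, f x.1 = (e x).1 :=
      fun x => dif_pos x.2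
    refine ⟨f, ⟨fun x hx => ?_, fun a ha b hb hab => ?_, fun w hw => ?_⟩, fun h hh => ?_⟩
    · have hx := (mem_smul_subgroup_iff N y _).1 hx
      rw [hf ⟨x, hx⟩]
      exact (mem_smul_subgroup_iff C v _).2 (e ⟨x, hx⟩).2
    · have ha := (mem_smul_subgroup_iff N y _).1 ha
      have hb := (mem_smul_subgroup_iff N y _).1 hb
      rw [hf ⟨a, ha⟩, hf ⟨b, hb⟩] at hab
      exact congrArg Subtype.val (e.injective (Subtype.ext hab))
    · have hw := (mem_smul_subgroup_iff C v _).1 hw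
      refine ⟨(e.symm ⟨w, hw⟩).1, (mem_smul_subgroup_iff N y _).2 (e.symm ⟨w, hw⟩).2, ?_⟩
      rw [hf, e.apply_symm_apply]
    · have h₁ : QuotientGroup.mk' N (y * h) = QuotientGroup.mk' N y :=
        (mem_smul_subgroup_iff N y _).1 ⟨h, hh, rfl⟩
      rw [hf ⟨y * h, h₁⟩]
      exact he ⟨y * h, h₁⟩

variable [Finite G]

theorem hasCosetBijection_iff_fiberDom (N : Subgroup G) [N.Normal] (y : G)
    (v : CyclicGrp (Nat.card G))
    (hv : orderOf (v : CyclicGrp (Nat.card G) ⧸ cyclicSub (Nat.card G) (Nat.card N)) =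
      orderOf (y : G ⧸ N)) :
    HasCosetBijection N y v ↔ FiberDom (QuotientGroup.mk' N) (y : G ⧸ N) := by
  have hG : Nat.card G ≠ 0 := Nat.card_pos.ne'
  have : NeZero (Nat.card G) := ⟨hG⟩
  have hC := card_cyclicSub (Nat.card G) (Nat.card N) hG N.card_subgroup_dvd_card
  have h := weightDom_fiber_cosetWeight
    (QuotientGroup.mk'_surjective (cyclicSub (Nat.card G) (Nat.card N)))
    (QuotientGroup.mk' _ v) hv (k := Nat.card N) (by rw [QuotientGroup.ker_mk', hC])
  have hN : Nat.card (QuotientGroup.mk' N).ker = Nat.card N := by rw [QuotientGroup.ker_mk']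
  rw [hasCosetBijection_iff, FiberDom, hN]
  exact ⟨fun h₁ => h₁.trans h.1, fun h₁ => h₁.trans h.2⟩

theorem InMin.fiberDom {n : ℕ} (hG : InMin n G) {Q : Type*} [Group Q] {φ : G →* Q}
    (hφ : Function.Surjective φ) (q : Q) : FiberDom φ q := by
  obtain ⟨y, rfl⟩ := hφ q
  have hG0 : Nat.card G ≠ 0 := Nat.card_pos.ne'
  have : NeZero (Nat.card G) := ⟨hG0⟩
  let C := cyclicSub (Nat.card G) (Nat.card φ.ker)
  have hC : Nat.card C = Nat.card φ.ker :=
    card_cyclicSub (Nat.card G) (Nat.card φ.ker) hG0 φ.ker.card_subgroup_dvd_card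
  have hcard : Nat.card (CyclicGrp (Nat.card G) ⧸ C) = Nat.card (G ⧸ φ.ker) := by
    have h₁ := Subgroup.card_eq_card_quotient_mul_card_subgroup φ.ker
    have h₂ := Subgroup.card_eq_card_quotient_mul_card_subgroup C
    rw [hC, Nat.card_congr Multiplicative.toAdd, Nat.card_zmod] at h₂
    exact (Nat.eq_of_mul_eq_mul_right Nat.card_pos (h₁.symm.trans h₂)).symm
  -- The cyclic quotient has the same order as G/ker φ, so a power of its generator has the order of
  -- the class of y and supplies the v at which membership in Min is applied.
  obtain ⟨g, hg⟩ := IsCyclic.exists_ofOrder_eq_natCard (α := CyclicGrp (Nat.card G) ⧸ C)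
  obtain ⟨w, hw⟩ := orderOf_dvd_natCard (y : G ⧸ φ.ker)
  have hw0 : w ≠ 0 := by
    rintro rfl
    exact Nat.card_pos.ne' hw
  obtain ⟨v, hv⟩ := QuotientGroup.mk'_surjective C (g ^ w)
  have hvy : orderOf (v : CyclicGrp (Nat.card G) ⧸ C) = orderOf (y : G ⧸ φ.ker) := by
    have hv' : (v : CyclicGrp (Nat.card G) ⧸ C) = g ^ w := hv
    rw [hv', orderOf_pow_of_dvd hw0 (by rw [hg, hcard, hw]; exact Dvd.intro_left _ rfl), hg, hcard,
      hw, Nat.mul_div_cancel _ (Nat.pos_of_ne_zero hw0)]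
  have h := (hasCosetBijection_iff_fiberDom φ.ker y v hvy).1 (hG.2.2 φ.ker y v hvy.symm)
  have hiff : ∀ x, φ x = φ y ↔ QuotientGroup.mk' φ.ker x = (y : G ⧸ φ.ker) := by
    intro x
    rw [φ.eq_iff, eq_comm]
    exact QuotientGroup.eq.symm
  refine h.of_equiv (Equiv.subtypeEquivRight hiff) (fun _ => rfl) ?_ ?_
  · have := (QuotientGroup.quotientKerEquivOfSurjective φ hφ).orderOf_eq (y : G ⧸ φ.ker)
    exact this.symm
  · rw [QuotientGroup.ker_mk']

end CosetBijection

/-! ### The main induction -/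

section MainInduction

variable {G : Type u} [Group G]

theorem IsMinimalNormalIn.isNonabelianSimple {N : Subgroup G} (hM : IsMinimalNormalIn N N)
    (hc : ¬ ∀ a ∈ N, ∀ b ∈ N, a * b = b * a) : IsNonabelianSimple N := by
  have : Nontrivial N := (Subgroup.nontrivial_iff_ne_bot N).2 hM.prop.2.2
  refine ⟨⟨fun K hK => ?_⟩, ?_⟩
  · by_cases h0 : K = ⊥
    · exact Or.inl h0
    · right
      have hle : N ≤ K.map N.subtype := by
        refine hM.le_of_le ⟨Subgroup.map_subtype_le K, le_normalizer_of_conj_mem ?_,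
          fun h => h0 ((Subgroup.map_eq_bot_iff_of_injective K N.subtype_injective).1 h)⟩
          (Subgroup.map_subtype_le K)
        rintro g hg _ ⟨x, hx, rfl⟩
        exact ⟨_, hK.conj_mem x hx ⟨g, hg⟩, rfl⟩
      rw [eq_top_iff]
      intro x _
      obtain ⟨z, hz, hzx⟩ := hle x.2
      exact Subtype.ext hzx ▸ hz
  · by_contra h
    push Not at h
    exact hc fun a ha b hb => congrArg Subtype.val (h ⟨a, ha⟩ ⟨b, hb⟩)

/-- An abelian normal subgroup cannot contain N, so it meets N trivially and therefore centralizes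
it. -/
theorem isSemisimpleGrp_of_centralizer_eq_bot {N : Subgroup G} (hN : IsMinimalNormal N)
    (hc : ¬ ∀ a ∈ N, ∀ b ∈ N, a * b = b * a) (hC : Subgroup.centralizer (N : Set G) = ⊥) :
    IsSemisimpleGrp G := by
  intro A hA hAc
  have hNn := hN.prop.1
  have hdisj : N ⊓ A = ⊥ := by
    by_contra h0
    have hle : N ≤ N ⊓ A := hN.le_of_le ⟨inferInstance, h0⟩ inf_le_left
    exact hc fun a ha b hb => hAc a (hle ha).2 b (hle hb).2
  rw [eq_bot_iff, ← hC]
  intro a ha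
  rw [Subgroup.mem_centralizer_iff]
  exact fun b hb => Subgroup.commute_of_normal_of_disjoint N A hNn hA
    (disjoint_iff.2 hdisj) b a hb ha

/-- The induced group is a quotient of the normalizer of M, so |B| ≥ |G| forces the normalizer to be
G and the action on M to be faithful. Then M is normal, equals ker φ, and has trivial centralizer.
-/
theorem IsMinimalNormalIn.inAM [Finite G] {Q : Type*} [Group Q] {φ : G →* Q} {M : Subgroup G}
    (hM : IsMinimalNormalIn M φ.ker)
    (hN : IsMinimalNormal φ.ker) (hc : ¬ ∀ a ∈ φ.ker, ∀ b ∈ φ.ker, a * b = b * a) {n : ℕ}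
    (hn : Nat.card G < n) (y : G) (hgen : Subgroup.zpowers (φ y) = ⊤)
    (hB : Nat.card G ≤ Nat.card (inducedAut M)) : InAM n G := by
  have h₁ : Nat.card (inducedAut M) ≤ Nat.card (Subgroup.normalizer (M : Set G)) :=
    Nat.card_le_card_of_surjective _ M.normalizerMonoidHom.rangeRestrict_surjective
  have hH : Subgroup.normalizer (M : Set G) = ⊤ :=
    Subgroup.eq_top_of_le_card _ (hB.trans h₁)
  have hMn : M.Normal := Subgroup.normalizer_eq_top_iff.1 hH
  have hMN : M = φ.ker :=
    le_antisymm hM.prop.1 (hN.le_of_le ⟨hMn, hM.prop.2.2⟩ hM.prop.1)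
  have hC : Subgroup.centralizer (M : Set G) = ⊥ := by
    have h₂ := (M.normalizerMonoidHom).card_ker_mul_card_range
    have h₃ : Nat.card M.normalizerMonoidHom.ker = 1 := by
      have h₄ : Nat.card (Subgroup.normalizer (M : Set G)) ≤ Nat.card (inducedAut M) :=
        (Subgroup.card_le_card_group _).trans hB
      have h₅ := le_antisymm h₁ h₄
      rw [h₅] at h₂
      exact Nat.eq_of_mul_eq_mul_right Nat.card_pos (h₂.trans (one_mul _).symm)
    have h₄ := Subgroup.eq_bot_of_card_eq _ h₃
    rw [eq_bot_iff]
    intro z hz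
    have hz' : (⟨z, Subgroup.centralizer_le_normalizer _ hz⟩ :
        Subgroup.normalizer (M : Set G)) ∈ M.normalizerMonoidHom.ker := by
      rw [Subgroup.normalizerMonoidHom_ker]
      exact hz
    rw [h₄, Subgroup.mem_bot] at hz'
    exact Subgroup.mem_bot.2 (congrArg Subtype.val hz')
  rw [hMN] at hC hM
  refine ⟨inferInstance, hn, isSemisimpleGrp_of_centralizer_eq_bot hN hc hC, y, φ.ker, hN, ?_,
    Or.inl (hM.isNonabelianSimple hc)⟩
  rw [eq_top_iff]
  intro g _
  obtain ⟨j, hj⟩ : φ g ∈ Subgroup.zpowers (φ y) := hgen ▸ Subgroup.mem_top _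
  rw [← mul_inv_cancel_left (y ^ j) g]
  refine Subgroup.mul_mem_sup (zpow_mem (Subgroup.mem_zpowers y) j) ?_
  rw [MonoidHom.mem_ker, map_mul, map_inv, map_zpow, ← hj]
  simp

theorem fiberDom_of_inAM_imp_inMin {n : ℕ}
    (hyp : ∀ (H : Type u) [Group H], InAM (n + 1) H → InMin (n + 1) H) (s : ℕ) (hs : s ≤ n) :
    ∀ (G : Type u) [Group G] [Finite G], Nat.card G = s → ∀ (Q : Type u) [Group Q] (φ : G →* Q),
      Function.Surjective φ → ∀ q, FiberDom φ q := by
  induction s using Nat.strong_induction_on with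
  | _ s ih =>
  intro G _ _ hG
  suffices h : ∀ (k : ℕ) (Q : Type u) [Group Q] (φ : G →* Q), Nat.card φ.ker = k →
      Function.Surjective φ → ∀ q, FiberDom φ q from fun Q _ φ => h _ Q φ rfl
  intro k
  induction k using Nat.strong_induction_on with
  | _ k ihk =>
  intro Q _ φ hk hφ q
  by_cases hbot : φ.ker = ⊥
  · obtain ⟨y, rfl⟩ := hφ q
    exact FiberDom.of_ker_eq_bot hbot y
  by_cases hgen : Subgroup.zpowers q = ⊤
  swap
  · have hlt : Nat.card ((Subgroup.zpowers q).comap φ) < s := by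
      rw [← hG]
      refine lt_of_le_of_ne (Subgroup.card_le_card_group _) fun h => hgen ?_
      rw [← Subgroup.map_comap_eq_self_of_surjective hφ (Subgroup.zpowers q),
        Subgroup.eq_top_of_card_eq _ h, Subgroup.map_top_of_surjective φ hφ]
    exact FiberDom.of_subgroupComap (ih _ hlt (hlt.le.trans hs) _ rfl _ _
      (φ.subgroupComap_surjective_of_surjective _ hφ) _)
  by_cases hmin : IsMinimalNormal φ.ker
  swap
  · obtain ⟨M, hMle, hM⟩ := exists_minimal_le_of_wellFoundedLT
      (fun K : Subgroup G => K.Normal ∧ K ≠ ⊥) φ.ker ⟨inferInstance, hbot⟩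
    have hMn := hM.prop.1
    have hMlt : M < φ.ker := lt_of_le_of_ne hMle fun h => hmin (h ▸ hM)
    let ψ : G ⧸ M →* Q := QuotientGroup.lift M φ hMle
    have hψ : Function.Surjective ψ := QuotientGroup.lift_surjective_of_surjective _ _ hφ _
    have hcomp : ψ.comp (QuotientGroup.mk' M) = φ := by
      ext x
      rfl
    have hMcard : 1 < Nat.card M := Subgroup.one_lt_card_iff_ne_bot M |>.2 hM.prop.2
    have hlt : Nat.card (G ⧸ M) < s := by
      rw [← hG, Subgroup.card_eq_card_quotient_mul_card_subgroup M]
      exact lt_mul_of_one_lt_right Nat.card_pos hMcard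
    rw [← hcomp]
    obtain ⟨y, rfl⟩ := hφ q
    refine FiberDom.comp (QuotientGroup.mk'_surjective M)
      (φ.isOfFinOrder (isOfFinOrder_of_finite y))
      (ih _ hlt (hlt.le.trans hs) _ rfl _ _ hψ _) fun q₁ _ => ?_
    -- Here the group is still G and only the kernel shrinks, which is why the inner induction is
    -- needed.
    refine ihk _ ?_ _ _ rfl (QuotientGroup.mk'_surjective M) q₁
    rw [QuotientGroup.ker_mk', ← hk]
    exact lt_of_le_of_ne (Subgroup.card_le_of_le hMle) fun h =>
      hMlt.ne (Subgroup.eq_of_le_of_card_ge hMle h.ge)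
  obtain ⟨y, rfl⟩ := hφ q
  by_cases hc : ∀ a ∈ φ.ker, ∀ b ∈ φ.ker, a * b = b * a
  · obtain ⟨p, hp, hpow⟩ := hmin.exists_prime_pow_eq_one hc
    exact FiberDom.of_forall_pow_prime_eq_one hp hpow y
  obtain ⟨M, hM⟩ := exists_isMinimalNormalIn hbot
  by_cases hB : Nat.card G ≤ Nat.card (inducedAut M)
  · exact (hyp G (hM.inAM hmin hc (by omega) y hgen hB)).fiberDom hφ _
  · refine FiberDom.of_inducedAut hM hmin hc y hgen fun q => ?_
    -- Here |B| < |G|, so the outer induction applies to B → B/Inn(M).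
    exact ih _ (by omega) (by omega) _ rfl _ _ (QuotientGroup.mk'_surjective _) q

theorem hasCyclicBijection_of_hasCosetBijection_top [Finite G]
    (h : HasCosetBijection (⊤ : Subgroup G) 1 1) : HasCyclicBijection (Nat.card G) G := by
  obtain ⟨f, hf, hd⟩ := h
  have : NeZero (Nat.card G) := ⟨Nat.card_pos.ne'⟩
  have h₁ : cyclicSub (Nat.card G) (Nat.card (⊤ : Subgroup G)) = ⊤ := by
    apply Subgroup.eq_top_of_card_eq
    rw [card_cyclicSub _ _ Nat.card_pos.ne' (Subgroup.card_subgroup_dvd_card _),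
      Nat.card_congr Subgroup.topEquiv.toEquiv, Nat.card_congr Multiplicative.toAdd, Nat.card_zmod]
  rw [h₁, one_smul, one_smul, Subgroup.coe_top, Subgroup.coe_top] at hf
  refine ⟨f, Set.bijOn_univ.1 hf, fun x => ?_⟩
  have h₂ := hd x (Subgroup.mem_top x)
  rwa [one_mul] at h₂

end MainInduction

theorem mainTheorem1 :
    (∀ n : ℕ, (∀ (H : Type u) [Group H], InAM (n + 1) H → InMin (n + 1) H) →
      ∀ (G : Type u) [Group G] [Finite G], Nat.card G = n →
        (∀ (N : Subgroup G) [N.Normal] (y : G) (v : CyclicGrp (Nat.card G)),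
          orderOf (v : CyclicGrp (Nat.card G) ⧸ cyclicSub (Nat.card G) (Nat.card N)) =
            orderOf (y : G ⧸ N) →
          HasCosetBijection N y v) ∧
        HasCyclicBijection n G) ∧
    ((∀ (n : ℕ) (H : Type u) [Group H], InAM n H → InMin n H) →
      ∀ (G : Type u) [Group G] [Finite G], HasCyclicBijection (Nat.card G) G) := by
  have key : ∀ n : ℕ, (∀ (H : Type u) [Group H], InAM (n + 1) H → InMin (n + 1) H) →
      ∀ (G : Type u) [Group G] [Finite G], Nat.card G = n →
        (∀ (N : Subgroup G) [N.Normal] (y : G) (v : CyclicGrp (Nat.card G)),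
          orderOf (v : CyclicGrp (Nat.card G) ⧸ cyclicSub (Nat.card G) (Nat.card N)) =
            orderOf (y : G ⧸ N) →
          HasCosetBijection N y v) ∧
        HasCyclicBijection n G := by
    intro n hyp G _ _ hG
    have h : ∀ (N : Subgroup G) [N.Normal] (y : G) (v : CyclicGrp (Nat.card G)),
        orderOf (v : CyclicGrp (Nat.card G) ⧸ cyclicSub (Nat.card G) (Nat.card N)) =
          orderOf (y : G ⧸ N) → HasCosetBijection N y v := fun N _ y v hv =>
      (hasCosetBijection_iff_fiberDom N y v hv).2 (fiberDom_of_inAM_imp_inMin hyp n le_rfl G hG _ _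
        (QuotientGroup.mk'_surjective N) _)
    refine ⟨h, hG ▸ hasCyclicBijection_of_hasCosetBijection_top (h ⊤ 1 1 ?_)⟩
    rw [QuotientGroup.mk_one, QuotientGroup.mk_one, orderOf_one, orderOf_one]
  exact ⟨key, fun hyp G _ _ => (key _ (hyp _) G rfl).2⟩
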